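/- **Setting.** Let $d\ge 1$, and let $\mathbb{H}^d$ be the set of $d\times d$ complex Hermitian matrices, with spectral norm $\|\cdot\|$, largest eigenvalue $\lambda_{\max}$, and normalized trace $\bar{\mathrm{tr}}\,\mathbf{B}=\frac1d\sum_{j} b_{jj}$. Let $(Z,Z')$ be an exchangeable pair of random variables with values in a Polish space $\mathcal{Z}$, that is, $(Z,Z')$ and $(Z',Z)$ have the same distribution. Let $\mathbf{\Psi}:\mathcal{Z}\to\mathbb{H}^d$ be measurable, and put $\mathbf{X}=\mathbf{\Psi}(Z)$ and $\mathbf{X}'=\mathbf{\Psi}(Z')$. Assume that $(\mathbf{X},\mathbf{X}')$ is a matrix Stein pair with scale factor $\alpha\in(0,1]$, that is, $$\mathbb{E}[\mathbf{X}-\mathbf{X}'\mid Z]=\alpha\mathbf{X}\quad\text{almost surely},\qquad \mathbb{E}\|\mathbf{X}\|^2<\infty .$$ Assume moreover that $\mathbf{X}$ is almost surely bounded in norm: there is a constant $B$ with $\|\mathbf{X}\|\le B$ almost surely. Let $$\mathbf{\Delta}_{\mathbf{X}}=\frac{1}{2\alpha}\,\mathbb{E}\big[(\mathbf{X}-\mathbf{X}')^2\mid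 Z\big]$$ be (any version of) the conditional variance of $\mathbf{X}$, and define $$r(\psi)=\frac1\psi\log\mathbb{E}\,\bar{\mathrm{tr}}\,e^{\psi\mathbf{\Delta}_{\mathbf{X}}}\qquad\text{for each }\psi>0 .$$ **Theorem (Refined Concentration for Random Matrices).** The expectations $\mathbb{E}\,\bar{\mathrm{tr}}\,e^{\psi\mathbf{\Delta}_{\mathbf{X}}}$ (for each $\psi>0$) and $\mathbb{E}\,\lambda_{\max}(\mathbf{X})$ exist and are finite. For all $t\ge 0$ and all $\psi>0$, $$\mathbb{P}\{\lambda_{\max}(\mathbf{X})\ge t\}\le d\cdot\exp\left\{\frac{-t^2}{2r(\psi)+2t/\sqrt{\psi}}\right\},$$ where for $t=0$ the exponential is read as $1$ (also if $r(\psi)=0$). Furthermore, for all $\psi>0$, $$\mathbb{E}\,\lambda_{\max}(\mathbf{X})\le\sqrt{2r(\psi)\log d}+\frac{\log d}{\sqrt{\psi}} .$$ -/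

import Mathlib

open MeasureTheory ProbabilityTheory

open scoped Matrix.Norms.L2Operator

noncomputable section

namespace MatrixStein

/-- The normalized trace `(1/d) ∑ j, b j j` of a `d × d` complex matrix. -/
def normTrace {d : ℕ} (B : Matrix (Fin d) (Fin d) ℂ) : ℂ :=
  (d : ℂ)⁻¹ * B.trace

/-- The largest eigenvalue of a Hermitian matrix of size at least one. The real spectrum is then
finite and nonempty, so that the supremum is a maximum. -/
def lambdaMax {d : ℕ} (A : Matrix (Fin d) (Fin d) ℂ) : ℝ :=
  sSup (spectrum ℝ A)

/-- `(Z, Z')` is an exchangeable pair of random variables: `(Z, Z')` and `(Z', Z)` have the same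
distribution. -/
structure IsExchangeablePair {Ω S : Type*} [MeasurableSpace Ω] [MeasurableSpace S]
    (μ : Measure Ω) (Z Z' : Ω → S) : Prop where
  measurable_left : Measurable Z
  measurable_right : Measurable Z'
  map_eq : μ.map (fun ω => (Z ω, Z' ω)) = μ.map (fun ω => (Z' ω, Z ω))

/-- The conditional expectation `E[W | Z]` of a random matrix, that is, the matrix of the
conditional expectations of its entries given the `σ`-algebra generated by `Z`. -/
def condExpMatrix {Ω S : Type*} [MeasurableSpace Ω] [MeasurableSpace S] {d : ℕ}
    (μ : Measure Ω) (Z : Ω → S) (W : Ω → Matrix (Fin d) (Fin d) ℂ) :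
    Ω → Matrix (Fin d) (Fin d) ℂ :=
  fun ω => Matrix.of fun i j =>
    (μ[fun ω' => W ω' i j | MeasurableSpace.comap Z inferInstance]) ω

/-- `(Ψ(Z), Ψ(Z'))` is a matrix Stein pair with scale factor `α`, constructed from the auxiliary
exchangeable pair `(Z, Z')`. The norm is the spectral norm. -/
structure IsMatrixSteinPair {Ω S : Type*} [MeasurableSpace Ω] [MeasurableSpace S] {d : ℕ}
    (μ : Measure Ω) (Z Z' : Ω → S) (Ψ : S → Matrix (Fin d) (Fin d) ℂ) (α : ℝ) : Prop where
  exchangeable : IsExchangeablePair μ Z Z'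
  measurable_entry : ∀ i j, Measurable fun z => Ψ z i j
  isHermitian : ∀ z, (Ψ z).IsHermitian
  scale_pos : 0 < α
  scale_le_one : α ≤ 1
  condExp_eq : condExpMatrix μ Z (fun ω => Ψ (Z ω) - Ψ (Z' ω)) =ᵐ[μ] fun ω => α • Ψ (Z ω)
  sq_integrable : Integrable (fun ω => ‖Ψ (Z ω)‖ ^ 2) μ

/-- The random matrix `Δ` is (a version of) the conditional variance
`(1 / (2α)) E[(X - X')² | Z]` of `X = Ψ(Z)`, where `X' = Ψ(Z')`. -/
def IsConditionalVariance {Ω S : Type*} [MeasurableSpace Ω] [MeasurableSpace S] {d : ℕ}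
    (μ : Measure Ω) (Z Z' : Ω → S) (Ψ : S → Matrix (Fin d) (Fin d) ℂ) (α : ℝ)
    (Δ : Ω → Matrix (Fin d) (Fin d) ℂ) : Prop :=
  Δ =ᵐ[μ] fun ω =>
    (1 / (2 * α)) • condExpMatrix μ Z (fun ω' => (Ψ (Z ω') - Ψ (Z' ω')) ^ 2) ω

/-- The normalized trace of the matrix exponential `e^{θ A}`; for Hermitian `A` this trace is
real. -/
def normTraceExp {d : ℕ} (θ : ℝ) (A : Matrix (Fin d) (Fin d) ℂ) : ℝ :=
  (normTrace (NormedSpace.exp (θ • A))).re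

/-- The function `r(ψ) = (1/ψ) log E tr̄ e^{ψ Δ}`. -/
def rFun {Ω : Type*} [MeasurableSpace Ω] {d : ℕ}
    (μ : Measure Ω) (Δ : Ω → Matrix (Fin d) (Fin d) ℂ) (ψ : ℝ) : ℝ :=
  (1 / ψ) * Real.log (∫ ω, normTraceExp ψ (Δ ω) ∂μ)

end MatrixStein

end

/-!
Write `X = Ψ(Z)`, `X' = Ψ(Z')`, and let `m θ = E tr̄ exp (θ X)` be the trace moment generating
function, where `tr̄` is the normalized trace. The matrix Laplace transform method bounds the upper
tail and the mean of the largest eigenvalue by means of `log (m θ)`, so that everything rests on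
`log_integral_normTraceExp_le`, the bound `log (m θ) ≤ r(ψ) θ² / (2 (1 - θ / √ψ))` for
`0 ≤ θ < √ψ`.

This bound comes from a differential inequality for `m' θ = E tr̄ (X exp (θ X))`. The Stein
condition turns `X` into `(X - X') / α`, exchangeability symmetrizes, and the mean value inequality
`tr ((A - B) (exp A - exp B)) ≤ tr ((A - B)² (exp A + exp B)) / 2` yields
`m' θ ≤ θ E tr̄ (Δ exp (θ X))` (`integral_reTrace_mul_exp_le`). Young's inequality for the quantum
entropy then separates `Δ` from `X`: `ψ E tr̄ (Δ exp (θ X)) ≤ θ m' θ + ψ r(ψ) m θ`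
(`integral_reTrace_condVar_mul_exp_le`), where `m θ ≥ 1` has been used. Together,
`m' θ (1 - θ² / ψ) ≤ r(ψ) θ m θ`, which `log_le_of_deriv_le` integrates.

Both trace inequalities have a scalar counterpart and compare sums of terms `tr (f(A) g(B))`. Each
such trace is a double sum of `f(a) g(b)` over the eigenvalues `a` of `A` and `b` of `B`, with
nonnegative weights independent of `f` and `g`, so that the scalar inequality transfers even though
`A` and `B` need not commute (`sum_reTrace_cfc_mul_cfc_nonneg`).

The boundedness of `X` makes every continuous function of `(X, X')` and of `(Δ, X)` integrable, and
justifies differentiating `m` under the expectation.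
-/

namespace MatrixStein

/-! ### Trace inequalities for Hermitian matrices -/

section TraceInequalities

variable {d : ℕ}

/-- The real part of the trace, as a continuous real-linear functional. -/
noncomputable def reTrace (d : ℕ) : Matrix (Fin d) (Fin d) ℂ →L[ℝ] ℝ :=
  LinearMap.toContinuousLinearMap (Complex.reLm ∘ₗ Matrix.traceLinearMap (Fin d) ℝ ℂ)

lemma reTrace_apply (A : Matrix (Fin d) (Fin d) ℂ) : reTrace d A = A.trace.re := rfl

lemma reTrace_mul_comm (A B : Matrix (Fin d) (Fin d) ℂ) :
    reTrace d (A * B) = reTrace d (B * A) := by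
  simp only [reTrace_apply, Matrix.trace_mul_comm A B]

lemma reTrace_one : reTrace d 1 = d := by simp [reTrace_apply]

lemma normTraceExp_eq (θ : ℝ) (A : Matrix (Fin d) (Fin d) ℂ) :
    normTraceExp θ A = (d : ℝ)⁻¹ * reTrace d (NormedSpace.exp (θ • A)) := by
  have h : (d : ℂ)⁻¹ = (((d : ℝ)⁻¹ : ℝ) : ℂ) := by push_cast; rfl
  rw [normTraceExp, normTrace, reTrace_apply, h, Complex.re_ofReal_mul]

/-- The trace of a product of functions of two Hermitian matrices is a double sum over the two
spectra, with nonnegative weights (the squared overlaps of the eigenvectors) that do not depend on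
the functions. -/
lemma exists_reTrace_cfc_mul_cfc {A B : Matrix (Fin d) (Fin d) ℂ} (hA : A.IsHermitian)
    (hB : B.IsHermitian) :
    ∃ (w : Fin d → Fin d → ℝ) (a b : Fin d → ℝ), (∀ i j, 0 ≤ w i j) ∧
      ∀ f g : ℝ → ℝ, reTrace d (cfc f A * cfc g B) = ∑ i, ∑ j, w i j * (f (a i) * g (b j)) := by
  let U : Matrix (Fin d) (Fin d) ℂ := (hA.eigenvectorUnitary).1
  let V : Matrix (Fin d) (Fin d) ℂ := (hB.eigenvectorUnitary).1
  set W : Matrix (Fin d) (Fin d) ℂ := star U * V with hW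
  refine ⟨fun i j => Complex.normSq (W i j), hA.eigenvalues, hB.eigenvalues,
    fun i j => Complex.normSq_nonneg _, fun f g => ?_⟩
  rw [hA.cfc_eq f, hB.cfc_eq g, Matrix.IsHermitian.cfc, Matrix.IsHermitian.cfc,
    Unitary.conjStarAlgAut_apply, Unitary.conjStarAlgAut_apply, reTrace_apply]
  set D : Matrix (Fin d) (Fin d) ℂ := Matrix.diagonal (RCLike.ofReal ∘ f ∘ hA.eigenvalues) with hD
  set E : Matrix (Fin d) (Fin d) ℂ := Matrix.diagonal (RCLike.ofReal ∘ g ∘ hB.eigenvalues) with hE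
  have h1 : (U * D * star U * (V * E * star V)).trace = (D * W * E * star W).trace := by
    have : U * D * star U * (V * E * star V) = U * (D * (star U * V) * E * star V) := by
      simp only [mul_assoc]
    rw [this, Matrix.trace_mul_comm]
    congr 1
    simp only [hW, star_mul, star_star, mul_assoc]
  change (U * D * star U * (V * E * star V)).trace.re = _
  rw [h1, Matrix.trace, Complex.re_sum]
  refine Finset.sum_congr rfl fun i _ => ?_
  rw [Matrix.diag_apply, Matrix.mul_apply, Complex.re_sum]
  refine Finset.sum_congr rfl fun j _ => ?_
  rw [hD, hE, Matrix.mul_diagonal, Matrix.diagonal_mul, Matrix.star_apply]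
  have h2 : ∀ (x y : ℝ) (z : ℂ), ((x : ℂ) * z * (y : ℂ) * star z).re
      = Complex.normSq z * (x * y) := by
    intro x y z
    simp [Complex.normSq_apply]
    ring
  exact h2 _ _ _

/-- An inequality between scalars of the form `∑ k, f k x * g k y ≥ 0` is inherited by the traces
of functions of two Hermitian matrices, whether or not these commute. -/
lemma sum_reTrace_cfc_mul_cfc_nonneg {A B : Matrix (Fin d) (Fin d) ℂ} (hA : A.IsHermitian)
    (hB : B.IsHermitian) {ι : Type*} (s : Finset ι) (f g : ι → ℝ → ℝ)
    (hfg : ∀ x y, 0 ≤ ∑ k ∈ s, f k x * g k y) :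
    0 ≤ ∑ k ∈ s, reTrace d (cfc (f k) A * cfc (g k) B) := by
  obtain ⟨w, a, b, hw, h⟩ := exists_reTrace_cfc_mul_cfc hA hB
  simp only [h]
  rw [Finset.sum_comm]
  refine Finset.sum_nonneg fun i _ => ?_
  rw [Finset.sum_comm]
  refine Finset.sum_nonneg fun j _ => ?_
  rw [← Finset.mul_sum]
  exact mul_nonneg (hw i j) (hfg _ _)

lemma cfc_exp {A : Matrix (Fin d) (Fin d) ℂ} (hA : A.IsHermitian) :
    cfc Real.exp A = NormedSpace.exp A :=
  CFC.real_exp_eq_normedSpace_exp hA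

lemma cfc_mul_exp {A : Matrix (Fin d) (Fin d) ℂ} (hA : A.IsHermitian) :
    cfc (fun x => x * Real.exp x) A = A * NormedSpace.exp A := by
  rw [cfc_mul (fun x : ℝ => x) Real.exp A, cfc_id' ℝ A (show IsSelfAdjoint A from hA), cfc_exp hA]

lemma cfc_sq_mul_exp {A : Matrix (Fin d) (Fin d) ℂ} (hA : A.IsHermitian) :
    cfc (fun x => x ^ 2 * Real.exp x) A = A ^ 2 * NormedSpace.exp A := by
  rw [cfc_mul (fun x : ℝ => x ^ 2) Real.exp A, cfc_pow (fun x : ℝ => x) 2 A,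
    cfc_id' ℝ A (show IsSelfAdjoint A from hA), cfc_exp hA]

lemma cfc_const_eq_smul_one {A : Matrix (Fin d) (Fin d) ℂ} (hA : A.IsHermitian) (c : ℝ) :
    cfc (fun _ => c) A = c • (1 : Matrix (Fin d) (Fin d) ℂ) := by
  rw [cfc_const c A hA.isSelfAdjoint, Algebra.algebraMap_eq_smul_one]

/-- The logarithmic mean of `exp x` and `exp y` is at most their arithmetic mean. -/
lemma sub_mul_exp_sub_exp_le (x y : ℝ) :
    (x - y) * (Real.exp x - Real.exp y) ≤ (x - y) ^ 2 * (Real.exp x + Real.exp y) / 2 := by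
  wlog hxy : y ≤ x generalizing x y
  · have := this y x (le_of_not_ge hxy)
    linarith
  -- With `t = x - y`, the claim is `g t ≥ 0` up to the factor `t * exp y`.
  let g : ℝ → ℝ := fun t => t * (Real.exp t + 1) / 2 - (Real.exp t - 1)
  have hg : ∀ t, HasDerivAt g
      ((1 * (Real.exp t + 1) + t * Real.exp t) / 2 - Real.exp t) t := fun t =>
    (((hasDerivAt_id t).mul ((Real.hasDerivAt_exp t).add_const 1)).div_const 2).sub
      ((Real.hasDerivAt_exp t).sub_const 1)
  have hmono : Monotone g := monotone_of_deriv_nonneg (fun t => (hg t).differentiableAt) fun t => by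
    rw [(hg t).deriv]
    have h1 := mul_le_mul_of_nonneg_left (Real.add_one_le_exp (-t)) (Real.exp_nonneg t)
    rw [← Real.exp_add, add_neg_cancel, Real.exp_zero] at h1
    linarith
  have h0 : 0 ≤ g (x - y) := by
    have := hmono (sub_nonneg.2 hxy)
    simpa [g] using this
  have h2 : Real.exp x = Real.exp y * Real.exp (x - y) := by rw [← Real.exp_add]; ring_nf
  have h3 := mul_nonneg (mul_nonneg (sub_nonneg.2 hxy) (Real.exp_nonneg y)) h0
  rw [h2]
  simp only [g] at h3
  linarith

/-- The mean value inequality for the trace of the exponential. -/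
lemma reTrace_sub_mul_exp_sub_exp_le {A B : Matrix (Fin d) (Fin d) ℂ} (hA : A.IsHermitian)
    (hB : B.IsHermitian) :
    reTrace d ((A - B) * (NormedSpace.exp A - NormedSpace.exp B)) ≤
      reTrace d ((A - B) ^ 2 * (NormedSpace.exp A + NormedSpace.exp B)) / 2 := by
  -- The ten products are the terms of the difference of both sides (times two) after expansion and
  -- cyclic rearrangement into functions of `A` times functions of `B`.
  have key := sum_reTrace_cfc_mul_cfc_nonneg hA hB (Finset.univ : Finset (Fin 10))
    ![fun x => x ^ 2 * Real.exp x, fun x => x ^ 2, fun x => x * Real.exp x, fun x => x,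
      fun x => Real.exp x, fun _ => 1, fun x => x * Real.exp x, fun x => x, fun x => Real.exp x,
      fun _ => 1]
    ![fun _ => 1, fun y => Real.exp y, fun y => -2 * y, fun y => -2 * (y * Real.exp y),
      fun y => y ^ 2, fun y => y ^ 2 * Real.exp y, fun _ => -2, fun y => 2 * Real.exp y,
      fun y => 2 * y, fun y => -2 * (y * Real.exp y)]
    (fun x y => by
      have := sub_mul_exp_sub_exp_le x y
      simp [Fin.sum_univ_succ]
      linarith)
  have hA' : IsSelfAdjoint A := hA
  have hB' : IsSelfAdjoint B := hB
  have e1 : cfc (fun x : ℝ => x ^ 2) A = A ^ 2 := by rw [cfc_pow (fun x : ℝ => x) 2 A, cfc_id' ℝ A]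
  have e2 : cfc (fun x : ℝ => x ^ 2) B = B ^ 2 := by rw [cfc_pow (fun x : ℝ => x) 2 B, cfc_id' ℝ B]
  have e3 : cfc (fun y : ℝ => -2 * y) B = (-2 : ℝ) • B := by
    rw [cfc_const_mul (-2) (fun y : ℝ => y) B, cfc_id' ℝ B]
  have e4 : cfc (fun y : ℝ => 2 * y) B = (2 : ℝ) • B := by
    rw [cfc_const_mul 2 (fun y : ℝ => y) B, cfc_id' ℝ B]
  have e5 : cfc (fun y : ℝ => -2 * (y * Real.exp y)) B = (-2 : ℝ) • (B * NormedSpace.exp B) := by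
    rw [cfc_const_mul (-2) (fun y : ℝ => y * Real.exp y) B, cfc_mul_exp hB]
  have e6 : cfc (fun y : ℝ => 2 * Real.exp y) B = (2 : ℝ) • NormedSpace.exp B := by
    rw [cfc_const_mul 2 Real.exp B, cfc_exp hB]
  simp only [Fin.sum_univ_succ, Matrix.cons_val_zero, Matrix.cons_val_succ,
    Finset.univ_eq_empty, Finset.sum_empty, add_zero, cfc_exp hA, cfc_exp hB,
    cfc_mul_exp hA, cfc_sq_mul_exp hA, cfc_sq_mul_exp hB, cfc_const_eq_smul_one hA,
    cfc_const_eq_smul_one hB, e1, e2, e3, e4, e5, e6,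
    cfc_id' ℝ A hA', mul_smul_comm, smul_mul_assoc, mul_one, one_mul, map_smul, smul_eq_mul] at key
  have r1 : reTrace d ((A - B) ^ 2 * (NormedSpace.exp A + NormedSpace.exp B)) =
      reTrace d (A ^ 2 * NormedSpace.exp A) + reTrace d (A ^ 2 * NormedSpace.exp B)
      - 2 * reTrace d (A * NormedSpace.exp A * B) - 2 * reTrace d (A * (B * NormedSpace.exp B))
      + reTrace d (NormedSpace.exp A * B ^ 2) + reTrace d (B ^ 2 * NormedSpace.exp B) := by
    have t1 : reTrace d (A * B * NormedSpace.exp A) = reTrace d (A * NormedSpace.exp A * B) := by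
      rw [mul_assoc, reTrace_mul_comm, mul_assoc, ← (Commute.refl A).exp_right.eq, reTrace_mul_comm]
    have t2 : reTrace d (B * A * NormedSpace.exp A) = reTrace d (A * NormedSpace.exp A * B) := by
      rw [mul_assoc, reTrace_mul_comm]
    have t3 : reTrace d (B * A * NormedSpace.exp B) = reTrace d (A * (B * NormedSpace.exp B)) := by
      rw [mul_assoc, reTrace_mul_comm, mul_assoc, ← (Commute.refl B).exp_right.eq]
    have t4 : reTrace d (B ^ 2 * NormedSpace.exp A) = reTrace d (NormedSpace.exp A * B ^ 2) :=
      reTrace_mul_comm _ _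
    have t5 : (A - B) ^ 2 * (NormedSpace.exp A + NormedSpace.exp B) =
        A ^ 2 * NormedSpace.exp A + A ^ 2 * NormedSpace.exp B - A * B * NormedSpace.exp A
        - B * A * NormedSpace.exp A - A * (B * NormedSpace.exp B) - B * A * NormedSpace.exp B
        + B ^ 2 * NormedSpace.exp A + B ^ 2 * NormedSpace.exp B := by noncomm_ring
    rw [t5]
    simp only [map_add, map_sub, t1, t2, t3, t4]
    ring
  have r2 : reTrace d ((A - B) * (NormedSpace.exp A - NormedSpace.exp B)) =
      reTrace d (A * NormedSpace.exp A) - reTrace d (A * NormedSpace.exp B)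
      - reTrace d (NormedSpace.exp A * B) + reTrace d (B * NormedSpace.exp B) := by
    rw [reTrace_mul_comm (NormedSpace.exp A) B, sub_mul, mul_sub, mul_sub]
    simp only [map_sub]
    ring
  rw [r1, r2]
  linarith

/-- Young's inequality for the quantum entropy, in exponential form: the matrix counterpart of
`v * exp y ≤ y * exp y - exp y + exp v`. -/
lemma reTrace_mul_exp_le {V Y : Matrix (Fin d) (Fin d) ℂ} (hV : V.IsHermitian)
    (hY : Y.IsHermitian) :
    reTrace d (V * NormedSpace.exp Y) ≤ reTrace d (Y * NormedSpace.exp Y)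
      - reTrace d (NormedSpace.exp Y) + reTrace d (NormedSpace.exp V) := by
  -- The scalar inequality is `exp (y - x) ≥ 1 + (y - x)`, multiplied by `exp x`.
  have key := sum_reTrace_cfc_mul_cfc_nonneg hY hV (Finset.univ : Finset (Fin 4))
    ![fun x => x * Real.exp x, fun x => Real.exp x, fun _ => 1, fun x => Real.exp x]
    ![fun _ => 1, fun _ => -1, fun y => Real.exp y, fun y => -1 * y]
    (fun x y => by
      have h1 := Real.add_one_le_exp (y - x)
      have h2 : Real.exp y = Real.exp x * Real.exp (y - x) := by rw [← Real.exp_add]; ring_nf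
      have h3 := mul_le_mul_of_nonneg_left h1 (Real.exp_nonneg x)
      simp [Fin.sum_univ_succ]
      linarith)
  have hY' : IsSelfAdjoint Y := hY
  have hV' : IsSelfAdjoint V := hV
  have e3 : cfc (fun y : ℝ => -1 * y) V = (-1 : ℝ) • V := by
    rw [cfc_const_mul (-1) (fun y : ℝ => y) V, cfc_id' ℝ V]
  simp only [Fin.sum_univ_succ, Matrix.cons_val_zero, Matrix.cons_val_succ,
    Finset.univ_eq_empty, Finset.sum_empty, add_zero, cfc_exp hY, cfc_exp hV,
    cfc_mul_exp hY, cfc_const_eq_smul_one hY, cfc_const_eq_smul_one hV, e3,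
    mul_smul_comm, smul_mul_assoc, mul_one, one_mul, map_smul,
    smul_eq_mul] at key
  rw [reTrace_mul_comm V]
  linarith

lemma card_add_reTrace_le_reTrace_exp {A : Matrix (Fin d) (Fin d) ℂ} (hA : A.IsHermitian) :
    d + reTrace d A ≤ reTrace d (NormedSpace.exp A) := by
  have h := reTrace_mul_exp_le hA (Matrix.isHermitian_zero (n := Fin d) (α := ℂ))
  simp only [NormedSpace.exp_zero, mul_one, map_zero, reTrace_one] at h
  linarith

lemma exp_add_smul_one (A : Matrix (Fin d) (Fin d) ℂ) (c : ℝ) :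
    NormedSpace.exp (A + c • (1 : Matrix (Fin d) (Fin d) ℂ)) =
      Real.exp c • NormedSpace.exp A := by
  have h1 : NormedSpace.exp (c • (1 : Matrix (Fin d) (Fin d) ℂ)) = Real.exp c • 1 := by
    rw [← Algebra.algebraMap_eq_smul_one, ← Algebra.algebraMap_eq_smul_one, Real.exp_eq_exp_ℝ,
      NormedSpace.algebraMap_exp_comm]
  rw [Matrix.exp_add_of_commute _ _ ((Commute.one_right A).smul_right c), h1, mul_smul_comm,
    mul_one]

open scoped ComplexOrder in
lemma reTrace_sq_nonneg {A : Matrix (Fin d) (Fin d) ℂ} (hA : A.IsHermitian) :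
    0 ≤ reTrace d (A ^ 2) := by
  have h1 := (Matrix.posSemidef_conjTranspose_mul_self A).trace_nonneg
  rw [hA.eq, ← sq] at h1
  exact (Complex.le_def.1 h1).1

/-! ### The largest eigenvalue -/

lemma reTrace_exp_smul_eq_sum {A : Matrix (Fin d) (Fin d) ℂ} (hA : A.IsHermitian) (θ : ℝ) :
    reTrace d (NormedSpace.exp (θ • A)) = ∑ i, Real.exp (θ * hA.eigenvalues i) := by
  have hA' : IsSelfAdjoint A := hA
  have h1 : NormedSpace.exp (θ • A) = cfc (fun x => Real.exp (θ * x)) A := by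
    rw [cfc_comp_const_mul θ Real.exp A, CFC.real_exp_eq_normedSpace_exp]
  rw [h1, hA.cfc_eq, Matrix.IsHermitian.cfc, Unitary.conjStarAlgAut_apply, reTrace_apply,
    Matrix.trace_mul_comm, ← mul_assoc]
  simp only [Unitary.coe_star_mul_self, one_mul, Matrix.trace_diagonal,
    Complex.re_sum]
  rfl

lemma eigenvalues_le_lambdaMax {A : Matrix (Fin d) (Fin d) ℂ} (hA : A.IsHermitian) (i : Fin d) :
    hA.eigenvalues i ≤ lambdaMax A := by
  rw [lambdaMax, hA.spectrum_real_eq_range_eigenvalues]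
  exact le_csSup (Set.finite_range _).bddAbove ⟨i, rfl⟩

lemma exists_eigenvalues_eq_lambdaMax (hd : 1 ≤ d) {A : Matrix (Fin d) (Fin d) ℂ}
    (hA : A.IsHermitian) : ∃ i, hA.eigenvalues i = lambdaMax A := by
  have : Nonempty (Fin d) := ⟨⟨0, hd⟩⟩
  rw [lambdaMax, hA.spectrum_real_eq_range_eigenvalues]
  exact (Set.range_nonempty _).csSup_mem (Set.finite_range _)

lemma exp_mul_lambdaMax_le (hd : 1 ≤ d) {A : Matrix (Fin d) (Fin d) ℂ} (hA : A.IsHermitian)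
    (θ : ℝ) : Real.exp (θ * lambdaMax A) ≤ reTrace d (NormedSpace.exp (θ • A)) := by
  obtain ⟨i, hi⟩ := exists_eigenvalues_eq_lambdaMax hd hA
  rw [reTrace_exp_smul_eq_sum hA, ← hi]
  exact Finset.single_le_sum (f := fun i => Real.exp (θ * hA.eigenvalues i))
    (fun _ _ => Real.exp_nonneg _) (Finset.mem_univ i)

lemma reTrace_exp_le_card_mul_exp_lambdaMax {A : Matrix (Fin d) (Fin d) ℂ} (hA : A.IsHermitian)
    {θ : ℝ} (hθ : 0 ≤ θ) :
    reTrace d (NormedSpace.exp (θ • A)) ≤ d * Real.exp (θ * lambdaMax A) := by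
  rw [reTrace_exp_smul_eq_sum hA]
  refine (Finset.sum_le_card_nsmul _ _ (Real.exp (θ * lambdaMax A)) fun i _ => ?_).trans_eq
    (by simp)
  exact Real.exp_le_exp.2 (mul_le_mul_of_nonneg_left (eigenvalues_le_lambdaMax hA i) hθ)

lemma abs_lambdaMax_le (hd : 1 ≤ d) {A : Matrix (Fin d) (Fin d) ℂ} (hA : A.IsHermitian) :
    |lambdaMax A| ≤ ‖A‖ * ‖(1 : Matrix (Fin d) (Fin d) ℂ)‖ := by
  obtain ⟨i, hi⟩ := exists_eigenvalues_eq_lambdaMax hd hA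
  rw [← hi, ← Real.norm_eq_abs]
  exact spectrum.norm_le_norm_mul_of_mem (hA.eigenvalues_mem_spectrum_real i)

end TraceInequalities

/-! ### Optimization of the Laplace transform bound -/

section Scalar

/-- Integration of the differential inequality for the trace moment generating function. -/
lemma log_le_of_deriv_le {m m' : ℝ → ℝ} {r ψ : ℝ} (hψ : 0 < ψ) (hr : 0 ≤ r)
    (hm : ∀ θ, HasDerivAt m (m' θ) θ) (h0 : m 0 = 1) (hpos : ∀ θ, 0 < m θ)
    (hineq : ∀ θ, 0 < θ → m' θ * (1 - θ ^ 2 / ψ) ≤ r * θ * m θ) {θ : ℝ} (hθ : 0 ≤ θ)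
    (hθψ : θ < √ψ) : Real.log (m θ) ≤ r * θ ^ 2 / (2 * (1 - θ / √ψ)) := by
  have hs : 0 < √ψ := Real.sqrt_pos.2 hψ
  have hq : θ / √ψ < 1 := (div_lt_one hs).2 hθψ
  have hq0 : 0 ≤ θ / √ψ := by positivity
  have hsq : θ ^ 2 / ψ = (θ / √ψ) ^ 2 := by rw [div_pow, Real.sq_sqrt hψ.le]
  set c : ℝ := 1 - θ ^ 2 / ψ with hc
  have hc1 : 1 - θ / √ψ ≤ c := by rw [hc, hsq]; nlinarith
  have hc0 : 0 < c := by linarith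
  let G : ℝ → ℝ := fun s => r / (2 * c) * s ^ 2 - Real.log (m s)
  have hG : ∀ s, HasDerivAt G (r / (2 * c) * (2 * s) - m' s / m s) s := fun s => by
    have h1 := (hasDerivAt_pow 2 s).const_mul (r / (2 * c))
    have h2 := (hm s).log (hpos s).ne'
    exact (h1.sub h2).congr_deriv (by simp)
  have hmono : MonotoneOn G (Set.Icc 0 θ) := by
    refine monotoneOn_of_deriv_nonneg (convex_Icc 0 θ)
      (fun s _ => (hG s).continuousAt.continuousWithinAt)
      (fun s _ => (hG s).differentiableAt.differentiableWithinAt) fun s hs' => ?_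
    rw [interior_Icc] at hs'
    rw [(hG s).deriv, sub_nonneg, div_le_iff₀ (hpos s)]
    have h1 := hineq s hs'.1
    have h2 : c ≤ 1 - s ^ 2 / ψ := by
      have : s ^ 2 / ψ ≤ θ ^ 2 / ψ :=
        div_le_div_of_nonneg_right (pow_le_pow_left₀ hs'.1.le hs'.2.le 2) hψ.le
      linarith
    have h3 : 0 ≤ r * s * m s := mul_nonneg (mul_nonneg hr hs'.1.le) (hpos s).le
    have h4 : m' s * c ≤ r * s * m s := by
      rcases le_total 0 (m' s) with h | h
      · exact (mul_le_mul_of_nonneg_left h2 h).trans h1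
      · exact (mul_nonpos_of_nonpos_of_nonneg h hc0.le).trans h3
    calc m' s ≤ r * s * m s / c := (le_div_iff₀ hc0).2 h4
      _ = r / (2 * c) * (2 * s) * m s := by field_simp
  have h1 := hmono (Set.left_mem_Icc.2 hθ) (Set.right_mem_Icc.2 hθ) hθ
  have h2 : Real.log (m θ) ≤ r * θ ^ 2 / (2 * c) := by
    have : r / (2 * c) * θ ^ 2 = r * θ ^ 2 / (2 * c) := by ring
    simp only [G, h0, Real.log_one] at h1
    linarith
  refine h2.trans (div_le_div_of_nonneg_left (by positivity) (by linarith) (by linarith))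

lemma le_mul_exp_of_forall_laplace {p D r ψ t : ℝ} (hψ : 0 < ψ) (hr : 0 ≤ r)
    (ht : 0 ≤ t)
    (h : ∀ θ, 0 ≤ θ → θ < √ψ → p ≤ D * Real.exp (-(θ * t) + r * θ ^ 2 / (2 * (1 - θ / √ψ)))) :
    p ≤ D * Real.exp (-t ^ 2 / (2 * r + 2 * t / √ψ)) := by
  have hs : 0 < √ψ := Real.sqrt_pos.2 hψ
  rcases ht.eq_or_lt with rfl | ht
  · simpa using h 0 le_rfl hs
  rcases hr.eq_or_lt with rfl | hr
  · -- The optimal `θ = √ψ` is excluded, but half of it suffices.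
    refine (h (√ψ / 2) (by positivity) (by linarith)).trans_eq ?_
    congr 2
    field_simp
    ring
  · have hE : 0 < r + t / √ψ := by positivity
    refine (h (t / (r + t / √ψ)) (by positivity) ?_).trans_eq ?_
    · rw [div_lt_iff₀ hE, mul_add, mul_div_cancel₀ _ hs.ne']
      have := mul_pos hs hr
      linarith
    · congr 2
      have h1 : 1 - t / (r + t / √ψ) / √ψ = r / (r + t / √ψ) := by
        field_simp
        ring
      rw [h1]
      field_simp
      ring

lemma le_sqrt_add_of_forall_laplace {E L r ψ : ℝ} (hψ : 0 < ψ) (hr : 0 ≤ r) (hL : 0 ≤ L)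
    (h : ∀ θ, 0 < θ → θ < √ψ → θ * E ≤ L + r * θ ^ 2 / (2 * (1 - θ / √ψ))) :
    E ≤ √(2 * r * L) + L / √ψ := by
  have hs : 0 < √ψ := Real.sqrt_pos.2 hψ
  -- Parametrize by `u = 1 / θ - 1 / √ψ`.
  have h1 : ∀ u, 0 < u → E ≤ L / √ψ + u * L + r / (2 * u) := fun u hu => by
    have hv : 0 < 1 / √ψ + u := by positivity
    have h2 := h (1 / (1 / √ψ + u)) (by positivity) (by
      rw [div_lt_iff₀ hv, mul_add, mul_one_div_cancel hs.ne']
      have := mul_pos hs hu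
      linarith)
    have h3 : 1 - 1 / (1 / √ψ + u) / √ψ = u / (1 / √ψ + u) := by
      field_simp
      ring
    rw [h3, one_div_mul_eq_div, div_le_iff₀ hv] at h2
    refine h2.trans_eq ?_
    field_simp
  -- The optimal `u` may be `0` or infinite; a perturbation of `r` and `L` avoids this.
  have h2 : ∀ ε, 0 < ε → E ≤ √(2 * (r + ε) * (L + ε)) + L / √ψ := fun ε hε => by
    have hr' : 0 < r + ε := by linarith
    have hL' : 0 < L + ε := by linarith
    set q := √(2 * (r + ε) * (L + ε)) with hq
    have hq0 : 0 < q := Real.sqrt_pos.2 (by positivity)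
    have hqq : q * q = 2 * (r + ε) * (L + ε) := Real.mul_self_sqrt (by positivity)
    have h3 := h1 (q / (2 * (L + ε))) (by positivity)
    have h4 : q / (2 * (L + ε)) * L ≤ q / 2 := by
      calc q / (2 * (L + ε)) * L ≤ q / (2 * (L + ε)) * (L + ε) :=
            mul_le_mul_of_nonneg_left (by linarith) (by positivity)
        _ = q / 2 := by field_simp
    have h5 : r / (2 * (q / (2 * (L + ε)))) ≤ q / 2 := by
      rw [div_le_iff₀ (by positivity)]
      calc r ≤ r + ε := by linarith
        _ = q * q / (2 * (L + ε)) := by rw [hqq]; field_simp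
        _ = q / 2 * (2 * (q / (2 * (L + ε)))) := by ring
    linarith
  have hcont : Continuous fun ε : ℝ => √(2 * (r + ε) * (L + ε)) + L / √ψ := by fun_prop
  have hlim := (hcont.tendsto 0).mono_left (nhdsWithin_le_nhds (s := Set.Ioi 0))
  simp only [add_zero] at hlim
  exact ge_of_tendsto hlim (Filter.eventually_of_mem self_mem_nhdsWithin fun ε hε => h2 ε hε)

end Scalar

/-! ### Exchangeable pairs and conditional expectations of random matrices -/

section Probability

@[fun_prop]
lemma continuous_exp_comp {d : ℕ} {E : Type*} [TopologicalSpace E]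
    {f : E → Matrix (Fin d) (Fin d) ℂ} (hf : Continuous f) :
    Continuous fun x => NormedSpace.exp (f x) := by
  let _ : NormedAlgebra ℚ (Matrix (Fin d) (Fin d) ℂ) := NormedAlgebra.restrictScalars ℚ ℝ _
  exact NormedSpace.exp_continuous.comp hf

variable {Ω S : Type*} [MeasurableSpace Ω] [MeasurableSpace S] {μ : Measure Ω}
  {d : ℕ} {Z Z' : Ω → S} {Ψ : S → Matrix (Fin d) (Fin d) ℂ} {α : ℝ}
  {Δ : Ω → Matrix (Fin d) (Fin d) ℂ}

lemma integrable_comp_of_ae_norm_le [IsFiniteMeasure μ] {E F : Type*} [NormedAddCommGroup E]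
    [ProperSpace E] [NormedAddCommGroup F] {Y : Ω → E} (hY : AEStronglyMeasurable Y μ) {B : ℝ}
    (hB : ∀ᵐ ω ∂μ, ‖Y ω‖ ≤ B) {f : E → F} (hf : Continuous f) :
    Integrable (fun ω => f (Y ω)) μ := by
  obtain ⟨C, hC⟩ := (isCompact_closedBall (0 : E) B).exists_bound_of_continuousOn hf.continuousOn
  refine Integrable.of_bound (hf.comp_aestronglyMeasurable hY) C ?_
  filter_upwards [hB] with ω hω
  exact hC _ (by simpa using hω)

lemma IsExchangeablePair.identDistrib (h : IsExchangeablePair μ Z Z') :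
    IdentDistrib (fun ω => (Z ω, Z' ω)) (fun ω => (Z' ω, Z ω)) μ μ where
  aemeasurable_fst := (h.measurable_left.prodMk h.measurable_right).aemeasurable
  aemeasurable_snd := (h.measurable_right.prodMk h.measurable_left).aemeasurable
  map_eq := h.map_eq

namespace IsMatrixSteinPair

variable (h : IsMatrixSteinPair μ Z Z' Ψ α)
include h

lemma stronglyMeasurable : StronglyMeasurable Ψ := by
  have h1 : Ψ = fun z => ∑ i, ∑ j, Matrix.single i j (Ψ z i j) :=
    funext fun z => Matrix.matrix_eq_sum_single _
  rw [h1]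
  refine Finset.stronglyMeasurable_fun_sum _ fun i _ =>
    Finset.stronglyMeasurable_fun_sum _ fun j _ => ?_
  have hc : Continuous fun c : ℂ => (Matrix.single i j c : Matrix (Fin d) (Fin d) ℂ) :=
    LinearMap.continuous_of_finiteDimensional
      (Matrix.singleLinearMap ℝ i j : ℂ →ₗ[ℝ] Matrix (Fin d) (Fin d) ℂ)
  exact hc.comp_stronglyMeasurable (h.measurable_entry i j).stronglyMeasurable

lemma aestronglyMeasurable_left : AEStronglyMeasurable (fun ω => Ψ (Z ω)) μ :=
  (h.stronglyMeasurable.comp_measurable h.exchangeable.measurable_left).aestronglyMeasurable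

lemma aestronglyMeasurable_pair : AEStronglyMeasurable (fun ω => (Ψ (Z ω), Ψ (Z' ω))) μ :=
  h.aestronglyMeasurable_left.prodMk
    (h.stronglyMeasurable.comp_measurable h.exchangeable.measurable_right).aestronglyMeasurable

lemma ae_norm_pair_le {B : ℝ} (hB : ∀ᵐ ω ∂μ, ‖Ψ (Z ω)‖ ≤ B) :
    ∀ᵐ ω ∂μ, ‖(Ψ (Z ω), Ψ (Z' ω))‖ ≤ B := by
  have h1 : IdentDistrib Z Z' μ μ := h.exchangeable.identDistrib.comp measurable_fst
  have h2 : MeasurableSet {z | ‖Ψ z‖ ≤ B} :=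
    h.stronglyMeasurable.norm.measurable measurableSet_Iic
  filter_upwards [hB, h1.ae_snd h2 hB] with ω h3 h4
  exact max_le h3 h4

lemma integral_swap {f : Matrix (Fin d) (Fin d) ℂ × Matrix (Fin d) (Fin d) ℂ → ℝ}
    (hf : Continuous f) :
    ∫ ω, f (Ψ (Z ω), Ψ (Z' ω)) ∂μ = ∫ ω, f (Ψ (Z' ω), Ψ (Z ω)) ∂μ := by
  have h1 : Measurable fun p : S × S => f (Ψ p.1, Ψ p.2) :=
    (hf.comp_stronglyMeasurable ((h.stronglyMeasurable.comp_measurable measurable_fst).prodMk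
      (h.stronglyMeasurable.comp_measurable measurable_snd))).measurable
  exact (h.exchangeable.identDistrib.comp h1).integral_eq

end IsMatrixSteinPair

/-- The entrywise conditional expectation agrees with the Bochner conditional expectation. -/
lemma condExpMatrix_ae_eq {W : Ω → Matrix (Fin d) (Fin d) ℂ} (hW : Integrable W μ) :
    condExpMatrix μ Z W =ᵐ[μ] μ[W | MeasurableSpace.comap Z inferInstance] := by
  have h1 : ∀ i j, ∀ᵐ ω ∂μ, (μ[W | MeasurableSpace.comap Z inferInstance]) ω i j =
      (μ[fun ω' => W ω' i j | MeasurableSpace.comap Z inferInstance]) ω := fun i j =>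
    ContinuousLinearMap.comp_condExp_comm hW
      (LinearMap.toContinuousLinearMap (Matrix.entryLinearMap ℝ ℂ i j))
  filter_upwards [ae_all_iff.2 fun i => ae_all_iff.2 (h1 i)] with ω hω
  ext i j
  exact (hω i j).symm

/-- A matrix that is a function of `Z` may be pulled out of a conditional expectation given `Z`
under the trace. -/
lemma integral_reTrace_condExp_mul [IsFiniteMeasure μ] {W : Ω → Matrix (Fin d) (Fin d) ℂ}
    {V : S → Matrix (Fin d) (Fin d) ℂ} (hZ : Measurable Z) (hW : Integrable W μ)
    (hV : StronglyMeasurable V) (hWV : Integrable (fun ω => reTrace d (W ω * V (Z ω))) μ) :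
    ∫ ω, reTrace d ((μ[W | MeasurableSpace.comap Z inferInstance]) ω * V (Z ω)) ∂μ =
      ∫ ω, reTrace d (W ω * V (Z ω)) ∂μ := by
  let T : Matrix (Fin d) (Fin d) ℂ →L[ℝ] Matrix (Fin d) (Fin d) ℂ →L[ℝ] ℝ :=
    (ContinuousLinearMap.compL ℝ _ _ _ (reTrace d)).comp (ContinuousLinearMap.mul ℝ _).flip
  have h1 := condExp_bilin_of_stronglyMeasurable_left (μ := μ) T
    (hV.comp_measurable (comap_measurable Z)) (g := W) hWV hW
  calc _ = ∫ ω, (μ[fun ω => T (V (Z ω)) (W ω) | MeasurableSpace.comap Z inferInstance]) ω ∂μ :=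
        integral_congr_ae h1.symm
    _ = _ := integral_condExp hZ.comap_le

namespace IsMatrixSteinPair

variable [IsProbabilityMeasure μ] (h : IsMatrixSteinPair μ Z Z' Ψ α)
  (hbdd : ∃ B : ℝ, ∀ᵐ ω ∂μ, ‖Ψ (Z ω)‖ ≤ B)
include h hbdd

lemma integrable_left {F : Type*} [NormedAddCommGroup F] {f : Matrix (Fin d) (Fin d) ℂ → F}
    (hf : Continuous f) : Integrable (fun ω => f (Ψ (Z ω))) μ := by
  obtain ⟨B, hB⟩ := hbdd
  exact integrable_comp_of_ae_norm_le h.aestronglyMeasurable_left hB hf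

lemma integrable_pair {F : Type*} [NormedAddCommGroup F]
    {f : Matrix (Fin d) (Fin d) ℂ × Matrix (Fin d) (Fin d) ℂ → F}
    (hf : Continuous f) : Integrable (fun ω => f (Ψ (Z ω), Ψ (Z' ω))) μ := by
  obtain ⟨B, hB⟩ := hbdd
  exact integrable_comp_of_ae_norm_le h.aestronglyMeasurable_pair (h.ae_norm_pair_le hB) hf

/-- The defining property of a matrix Stein pair, tested against functions of `X`. -/
lemma integral_reTrace_mul {f : Matrix (Fin d) (Fin d) ℂ → Matrix (Fin d) (Fin d) ℂ}
    (hf : Continuous f) :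
    α * ∫ ω, reTrace d (Ψ (Z ω) * f (Ψ (Z ω))) ∂μ =
      ∫ ω, reTrace d ((Ψ (Z ω) - Ψ (Z' ω)) * f (Ψ (Z ω))) ∂μ := by
  have hW : Integrable (fun ω => Ψ (Z ω) - Ψ (Z' ω)) μ :=
    h.integrable_pair hbdd (f := fun p => p.1 - p.2) (by fun_prop)
  rw [← integral_reTrace_condExp_mul (V := fun z => f (Ψ z)) h.exchangeable.measurable_left hW
    (hf.comp_stronglyMeasurable h.stronglyMeasurable)
    (h.integrable_pair hbdd (f := fun p => reTrace d ((p.1 - p.2) * f p.1)) (by fun_prop)),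
    ← integral_const_mul]
  refine integral_congr_ae ?_
  filter_upwards [condExpMatrix_ae_eq (Z := Z) hW, h.condExp_eq] with ω h1 h2
  rw [← h1, h2, smul_mul_assoc, map_smul, smul_eq_mul]

lemma integrable_sq_sub : Integrable (fun ω => (Ψ (Z ω) - Ψ (Z' ω)) ^ 2) μ :=
  h.integrable_pair hbdd (f := fun p => (p.1 - p.2) ^ 2) (by fun_prop)

lemma condVar_ae_eq (hΔ : IsConditionalVariance μ Z Z' Ψ α Δ) :
    Δ =ᵐ[μ] fun ω => (1 / (2 * α)) •
      (μ[fun ω' => (Ψ (Z ω') - Ψ (Z' ω')) ^ 2 | MeasurableSpace.comap Z inferInstance]) ω := by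
  filter_upwards [hΔ, condExpMatrix_ae_eq (Z := Z) (h.integrable_sq_sub hbdd)] with ω h1 h2
  rw [h1, h2]

/-- The defining property of the conditional variance, tested against functions of `X`. -/
lemma integral_reTrace_condVar_mul (hΔ : IsConditionalVariance μ Z Z' Ψ α Δ)
    {f : Matrix (Fin d) (Fin d) ℂ → Matrix (Fin d) (Fin d) ℂ} (hf : Continuous f) :
    ∫ ω, reTrace d (Δ ω * f (Ψ (Z ω))) ∂μ =
      1 / (2 * α) * ∫ ω, reTrace d ((Ψ (Z ω) - Ψ (Z' ω)) ^ 2 * f (Ψ (Z ω))) ∂μ := by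
  rw [← integral_reTrace_condExp_mul (V := fun z => f (Ψ z)) h.exchangeable.measurable_left
    (h.integrable_sq_sub hbdd) (hf.comp_stronglyMeasurable h.stronglyMeasurable)
    (h.integrable_pair hbdd (f := fun p => reTrace d ((p.1 - p.2) ^ 2 * f p.1)) (by fun_prop)),
    ← integral_const_mul]
  refine integral_congr_ae ?_
  filter_upwards [h.condVar_ae_eq hbdd hΔ] with ω h1
  rw [h1, smul_mul_assoc, map_smul, smul_eq_mul]

lemma aestronglyMeasurable_condVar (hΔ : IsConditionalVariance μ Z Z' Ψ α Δ) :
    AEStronglyMeasurable Δ μ := by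
  have h1 : AEStronglyMeasurable (μ[fun ω' => (Ψ (Z ω') - Ψ (Z' ω')) ^ 2 |
      MeasurableSpace.comap Z inferInstance]) μ :=
    (stronglyMeasurable_condExp.mono
      h.exchangeable.measurable_left.comap_le).aestronglyMeasurable
  exact (h1.const_smul (1 / (2 * α))).congr (h.condVar_ae_eq hbdd hΔ).symm

lemma exists_ae_norm_condVar_le (hΔ : IsConditionalVariance μ Z Z' Ψ α Δ) :
    ∃ B : ℝ, ∀ᵐ ω ∂μ, ‖Δ ω‖ ≤ B := by
  obtain ⟨B, hB⟩ := hbdd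
  have h1 : ∀ᵐ ω ∂μ, ‖(Ψ (Z ω) - Ψ (Z' ω)) ^ 2‖ ≤ (B + B) ^ 2 := by
    filter_upwards [h.ae_norm_pair_le hB] with ω hω
    refine (norm_pow_le' _ two_pos).trans (pow_le_pow_left₀ (norm_nonneg _) ?_ 2)
    exact (norm_sub_le _ _).trans
      (add_le_add ((norm_fst_le _).trans hω) ((norm_snd_le _).trans hω))
  refine ⟨‖1 / (2 * α)‖ * (B + B) ^ 2, ?_⟩
  filter_upwards [h.condVar_ae_eq ⟨B, hB⟩ hΔ,
    ae_bdd_norm_condExp_of_ae_bdd_norm (m := MeasurableSpace.comap Z inferInstance) h1]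
    with ω h2 h3
  rw [h2, norm_smul]
  exact mul_le_mul_of_nonneg_left h3 (norm_nonneg _)

lemma integrable_condVar_left (hΔ : IsConditionalVariance μ Z Z' Ψ α Δ) {F : Type*}
    [NormedAddCommGroup F] {f : Matrix (Fin d) (Fin d) ℂ × Matrix (Fin d) (Fin d) ℂ → F}
    (hf : Continuous f) : Integrable (fun ω => f (Δ ω, Ψ (Z ω))) μ := by
  obtain ⟨B, hB⟩ := hbdd
  obtain ⟨B', hB'⟩ := h.exists_ae_norm_condVar_le ⟨B, hB⟩ hΔ
  refine integrable_comp_of_ae_norm_le (B := max B' B)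
    ((h.aestronglyMeasurable_condVar ⟨B, hB⟩ hΔ).prodMk h.aestronglyMeasurable_left) ?_ hf
  filter_upwards [hB, hB'] with ω h1 h2
  exact max_le_max h2 h1

lemma ae_isHermitian_condVar (hΔ : IsConditionalVariance μ Z Z' Ψ α Δ) :
    ∀ᵐ ω ∂μ, (Δ ω).IsHermitian := by
  have h1 := ContinuousLinearMap.comp_condExp_comm (m := MeasurableSpace.comap Z inferInstance)
    (h.integrable_sq_sub hbdd) (starL' ℝ : _ ≃L[ℝ] _).toContinuousLinearMap
  have h2 : ∀ ω, star ((Ψ (Z ω) - Ψ (Z' ω)) ^ 2) = (Ψ (Z ω) - Ψ (Z' ω)) ^ 2 := fun ω =>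
    (((h.isHermitian (Z ω)).sub (h.isHermitian (Z' ω))).pow 2).eq
  have h3 : (⇑(starL' ℝ : _ ≃L[ℝ] _).toContinuousLinearMap ∘
      fun ω => (Ψ (Z ω) - Ψ (Z' ω)) ^ 2) = fun ω => (Ψ (Z ω) - Ψ (Z' ω)) ^ 2 := funext h2
  rw [h3] at h1
  filter_upwards [h1, h.condVar_ae_eq hbdd hΔ] with ω h4 h5
  have h6 : star ((μ[fun ω' => (Ψ (Z ω') - Ψ (Z' ω')) ^ 2 |
      MeasurableSpace.comap Z inferInstance]) ω) = _ := h4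
  rw [Matrix.IsHermitian, ← Matrix.star_eq_conjTranspose, h5, star_smul, h6, star_trivial]

end IsMatrixSteinPair

end Probability

/-! ### The trace moment generating function -/

section TraceMgf

variable {Ω S : Type*} [MeasurableSpace Ω] [MeasurableSpace S] {μ : Measure Ω}
  [IsProbabilityMeasure μ]
  {d : ℕ} {Z Z' : Ω → S} {Ψ : S → Matrix (Fin d) (Fin d) ℂ} {α : ℝ}
  {Δ : Ω → Matrix (Fin d) (Fin d) ℂ}

namespace IsMatrixSteinPair

variable (h : IsMatrixSteinPair μ Z Z' Ψ α)
  (hbdd : ∃ B : ℝ, ∀ᵐ ω ∂μ, ‖Ψ (Z ω)‖ ≤ B)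
include h hbdd

lemma integral_reTrace_eq_zero : ∫ ω, reTrace d (Ψ (Z ω)) ∂μ = 0 := by
  have h1 := h.integral_reTrace_mul hbdd (f := fun _ => 1) continuous_const
  have h2 : ∫ ω, reTrace d (Ψ (Z' ω)) ∂μ = ∫ ω, reTrace d (Ψ (Z ω)) ∂μ :=
    h.integral_swap (f := fun p => reTrace d p.2) (by fun_prop)
  simp only [mul_one, map_sub] at h1
  rw [integral_sub (h.integrable_pair hbdd (f := fun p => reTrace d p.1) (by fun_prop))
    (h.integrable_pair hbdd (f := fun p => reTrace d p.2) (by fun_prop)), h2, sub_self] at h1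
  exact (mul_eq_zero.1 h1).resolve_left h.scale_pos.ne'

/-- The exchangeability of the pair and the mean value trace inequality bound the derivative of the
trace moment generating function by means of the conditional variance. -/
lemma integral_reTrace_mul_exp_le (hΔ : IsConditionalVariance μ Z Z' Ψ α Δ) {θ : ℝ} (hθ : 0 < θ) :
    ∫ ω, reTrace d (Ψ (Z ω) * NormedSpace.exp (θ • Ψ (Z ω))) ∂μ ≤
      θ * ∫ ω, reTrace d (Δ ω * NormedSpace.exp (θ • Ψ (Z ω))) ∂μ := by
  have hα := h.scale_pos
  have hf : Continuous fun A : Matrix (Fin d) (Fin d) ℂ => NormedSpace.exp (θ • A) := by fun_prop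
  have h1 := h.integral_reTrace_mul hbdd hf
  have h2 := h.integral_reTrace_condVar_mul hbdd hΔ hf
  -- Exchangeability symmetrizes both integrals over the pair.
  have h3 : 2 * ∫ ω, reTrace d ((Ψ (Z ω) - Ψ (Z' ω)) * NormedSpace.exp (θ • Ψ (Z ω))) ∂μ =
      ∫ ω, reTrace d ((Ψ (Z ω) - Ψ (Z' ω)) *
        (NormedSpace.exp (θ • Ψ (Z ω)) - NormedSpace.exp (θ • Ψ (Z' ω)))) ∂μ := by
    have hs := h.integral_swap (f := fun p => reTrace d ((p.1 - p.2) * NormedSpace.exp (θ • p.1)))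
      (by fun_prop)
    have hi := h.integrable_pair hbdd
      (f := fun p => reTrace d ((p.1 - p.2) * NormedSpace.exp (θ • p.1))) (by fun_prop)
    have hi' := h.integrable_pair hbdd
      (f := fun p => reTrace d ((p.2 - p.1) * NormedSpace.exp (θ • p.2))) (by fun_prop)
    rw [two_mul]
    nth_rewrite 2 [hs]
    rw [← integral_add hi hi']
    refine integral_congr_ae (.of_forall fun ω => ?_)
    simp only [← map_add]
    congr 1
    noncomm_ring
  have h4 : 2 * ∫ ω, reTrace d ((Ψ (Z ω) - Ψ (Z' ω)) ^ 2 * NormedSpace.exp (θ • Ψ (Z ω))) ∂μ =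
      ∫ ω, reTrace d ((Ψ (Z ω) - Ψ (Z' ω)) ^ 2 *
        (NormedSpace.exp (θ • Ψ (Z ω)) + NormedSpace.exp (θ • Ψ (Z' ω)))) ∂μ := by
    have hs := h.integral_swap
      (f := fun p => reTrace d ((p.1 - p.2) ^ 2 * NormedSpace.exp (θ • p.1))) (by fun_prop)
    have hi := h.integrable_pair hbdd
      (f := fun p => reTrace d ((p.1 - p.2) ^ 2 * NormedSpace.exp (θ • p.1))) (by fun_prop)
    have hi' := h.integrable_pair hbdd
      (f := fun p => reTrace d ((p.2 - p.1) ^ 2 * NormedSpace.exp (θ • p.2))) (by fun_prop)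
    rw [two_mul]
    nth_rewrite 2 [hs]
    rw [← integral_add hi hi']
    refine integral_congr_ae (.of_forall fun ω => ?_)
    simp only [← map_add]
    congr 1
    noncomm_ring
  have h5 : ∫ ω, reTrace d ((Ψ (Z ω) - Ψ (Z' ω)) *
        (NormedSpace.exp (θ • Ψ (Z ω)) - NormedSpace.exp (θ • Ψ (Z' ω)))) ∂μ ≤
      θ / 2 * ∫ ω, reTrace d ((Ψ (Z ω) - Ψ (Z' ω)) ^ 2 *
        (NormedSpace.exp (θ • Ψ (Z ω)) + NormedSpace.exp (θ • Ψ (Z' ω)))) ∂μ := by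
    rw [← integral_const_mul]
    refine integral_mono
      (h.integrable_pair hbdd (f := fun p => reTrace d ((p.1 - p.2) *
        (NormedSpace.exp (θ • p.1) - NormedSpace.exp (θ • p.2)))) (by fun_prop))
      (h.integrable_pair hbdd (f := fun p => θ / 2 * reTrace d ((p.1 - p.2) ^ 2 *
        (NormedSpace.exp (θ • p.1) + NormedSpace.exp (θ • p.2)))) (by fun_prop)) fun ω => ?_
    have hH : ∀ z, (θ • Ψ z).IsHermitian := fun z =>
      (IsSelfAdjoint.all θ).smul (h.isHermitian z).isSelfAdjoint
    have h6 := reTrace_sub_mul_exp_sub_exp_le (hH (Z ω)) (hH (Z' ω))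
    rw [← smul_sub, smul_pow, smul_mul_assoc, smul_mul_assoc, map_smul, map_smul, smul_eq_mul,
      smul_eq_mul] at h6
    refine le_of_mul_le_mul_left (h6.trans_eq ?_) hθ
    ring
  rw [h2]
  refine le_of_mul_le_mul_left ?_ hα
  rw [h1]
  calc _ ≤ θ / 4 * ∫ ω, reTrace d ((Ψ (Z ω) - Ψ (Z' ω)) ^ 2 *
        (NormedSpace.exp (θ • Ψ (Z ω)) + NormedSpace.exp (θ • Ψ (Z' ω)))) ∂μ := by linarith
    _ = _ := by
      rw [← h4]
      field_simp
      ring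

lemma hasDerivAt_integral_reTrace_exp (θ : ℝ) :
    HasDerivAt (fun θ : ℝ => ∫ ω, reTrace d (NormedSpace.exp (θ • Ψ (Z ω))) ∂μ)
      (∫ ω, reTrace d (Ψ (Z ω) * NormedSpace.exp (θ • Ψ (Z ω))) ∂μ) θ := by
  obtain ⟨B, hB⟩ := id hbdd
  have hc : Continuous fun q : ℝ × Matrix (Fin d) (Fin d) ℂ =>
      reTrace d (q.2 * NormedSpace.exp (q.1 • q.2)) := by fun_prop
  obtain ⟨C, hC⟩ := ((isCompact_closedBall θ 1).prod
    (isCompact_closedBall (0 : Matrix (Fin d) (Fin d) ℂ) B)).exists_bound_of_continuousOn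
      hc.continuousOn
  refine (hasDerivAt_integral_of_dominated_loc_of_deriv_le (bound := fun _ => C)
    (s := Metric.closedBall θ 1)
    (F := fun (θ : ℝ) ω => reTrace d (NormedSpace.exp (θ • Ψ (Z ω))))
    (F' := fun (θ : ℝ) ω => reTrace d (Ψ (Z ω) * NormedSpace.exp (θ • Ψ (Z ω))))
    (Metric.closedBall_mem_nhds θ one_pos) (.of_forall fun s => ?_) ?_ ?_ ?_
    (integrable_const C) (.of_forall fun ω s _ => ?_)).2
  · exact (h.integrable_left hbdd (f := fun A => reTrace d (NormedSpace.exp (s • A)))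
      (by fun_prop)).aestronglyMeasurable
  · exact h.integrable_left hbdd (f := fun A => reTrace d (NormedSpace.exp (θ • A))) (by fun_prop)
  · exact (h.integrable_left hbdd (f := fun A => reTrace d (A * NormedSpace.exp (θ • A)))
      (by fun_prop)).aestronglyMeasurable
  · filter_upwards [hB] with ω hω s hs
    exact hC (s, Ψ (Z ω)) ⟨hs, by simpa using hω⟩
  · exact (reTrace d).hasFDerivAt.comp_hasDerivAt s (hasDerivAt_exp_smul_const' (Ψ (Z ω)) s)

lemma integrable_normTraceExp_condVar (hΔ : IsConditionalVariance μ Z Z' Ψ α Δ) (ψ : ℝ) :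
    Integrable (fun ω => normTraceExp ψ (Δ ω)) μ := by
  simp only [normTraceExp_eq]
  exact h.integrable_condVar_left hbdd hΔ
    (f := fun p => (d : ℝ)⁻¹ * reTrace d (NormedSpace.exp (ψ • p.1))) (by fun_prop)

lemma integrable_normTraceExp (θ : ℝ) : Integrable (fun ω => normTraceExp θ (Ψ (Z ω))) μ := by
  simp only [normTraceExp_eq]
  exact h.integrable_left hbdd
    (f := fun A => (d : ℝ)⁻¹ * reTrace d (NormedSpace.exp (θ • A))) (by fun_prop)

lemma one_le_integral_normTraceExp (hd : 1 ≤ d) (θ : ℝ) :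
    1 ≤ ∫ ω, normTraceExp θ (Ψ (Z ω)) ∂μ := by
  have hd' : (0 : ℝ) < d := by exact_mod_cast hd
  have h1 : ∫ ω, (1 + θ / d * reTrace d (Ψ (Z ω))) ∂μ = 1 := by
    rw [integral_add (integrable_const _) ((h.integrable_left hbdd (by fun_prop)).const_mul _),
      integral_const_mul, h.integral_reTrace_eq_zero hbdd]
    simp
  refine h1.symm.trans_le (integral_mono
    (h.integrable_left hbdd (f := fun A => 1 + θ / d * reTrace d A) (by fun_prop))
    (h.integrable_normTraceExp hbdd θ) fun ω => ?_)
  have h2 := card_add_reTrace_le_reTrace_exp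
    ((IsSelfAdjoint.all θ).smul (h.isHermitian (Z ω)).isSelfAdjoint)
  rw [map_smul, smul_eq_mul] at h2
  simp only [normTraceExp_eq]
  rw [inv_mul_eq_div, le_div_iff₀ hd']
  refine Eq.trans_le ?_ h2
  field_simp

lemma one_le_integral_normTraceExp_condVar (hd : 1 ≤ d)
    (hΔ : IsConditionalVariance μ Z Z' Ψ α Δ) {ψ : ℝ} (hψ : 0 < ψ) :
    1 ≤ ∫ ω, normTraceExp ψ (Δ ω) ∂μ := by
  have hd' : (0 : ℝ) < d := by exact_mod_cast hd
  have hα := h.scale_pos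
  have h0 : 0 ≤ ∫ ω, reTrace d (Δ ω) ∂μ := by
    have h1 := h.integral_reTrace_condVar_mul hbdd hΔ (f := fun _ => 1) continuous_const
    simp only [mul_one] at h1
    rw [h1]
    exact mul_nonneg (by positivity) (integral_nonneg fun ω =>
      reTrace_sq_nonneg ((h.isHermitian (Z ω)).sub (h.isHermitian (Z' ω))))
  have hi : Integrable (fun ω => reTrace d (Δ ω)) μ :=
    h.integrable_condVar_left hbdd hΔ (f := fun p => reTrace d p.1) (by fun_prop)
  have h1 : 1 ≤ ∫ ω, (1 + ψ / d * reTrace d (Δ ω)) ∂μ := by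
    rw [integral_add (integrable_const _) (hi.const_mul _), integral_const_mul]
    have : 0 ≤ ψ / d * ∫ ω, reTrace d (Δ ω) ∂μ := by positivity
    simpa using this
  refine h1.trans (integral_mono_ae ((integrable_const _).add (hi.const_mul _))
    (h.integrable_normTraceExp_condVar hbdd hΔ ψ) ?_)
  filter_upwards [h.ae_isHermitian_condVar hbdd hΔ] with ω hω
  have h2 := card_add_reTrace_le_reTrace_exp ((IsSelfAdjoint.all ψ).smul hω.isSelfAdjoint)
  rw [map_smul, smul_eq_mul] at h2
  simp only [normTraceExp_eq]
  rw [inv_mul_eq_div, le_div_iff₀ hd']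
  refine Eq.trans_le ?_ h2
  field_simp

lemma rFun_nonneg (hd : 1 ≤ d) (hΔ : IsConditionalVariance μ Z Z' Ψ α Δ) {ψ : ℝ} (hψ : 0 < ψ) :
    0 ≤ rFun μ Δ ψ :=
  mul_nonneg (by positivity)
    (Real.log_nonneg (h.one_le_integral_normTraceExp_condVar hbdd hd hΔ hψ))

/-- Young's inequality for the quantum entropy separates the conditional variance from `X`. The
shift of `ψ • Δ` by a multiple of the identity that makes the two exponential traces cancel is
`c = log E tr̄ exp (ψ Δ) - log E tr̄ exp (θ X)`. -/
lemma integral_reTrace_condVar_mul_exp_le (hd : 1 ≤ d)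
    (hΔ : IsConditionalVariance μ Z Z' Ψ α Δ) {ψ : ℝ} (hψ : 0 < ψ) (θ : ℝ) :
    ψ * ∫ ω, reTrace d (Δ ω * NormedSpace.exp (θ • Ψ (Z ω))) ∂μ ≤
      θ * ∫ ω, reTrace d (Ψ (Z ω) * NormedSpace.exp (θ • Ψ (Z ω))) ∂μ +
        ψ * rFun μ Δ ψ * ∫ ω, reTrace d (NormedSpace.exp (θ • Ψ (Z ω))) ∂μ := by
  have hd' : (0 : ℝ) < d := by exact_mod_cast hd
  set m := ∫ ω, normTraceExp θ (Ψ (Z ω)) ∂μ with hm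
  set v := ∫ ω, normTraceExp ψ (Δ ω) ∂μ with hv
  have hm1 : 1 ≤ m := h.one_le_integral_normTraceExp hbdd hd θ
  have hv1 : 1 ≤ v := h.one_le_integral_normTraceExp_condVar hbdd hd hΔ hψ
  have hM : ∫ ω, reTrace d (NormedSpace.exp (θ • Ψ (Z ω))) ∂μ = d * m := by
    simp only [hm, normTraceExp_eq, integral_const_mul]
    field_simp
  have hV : ∫ ω, reTrace d (NormedSpace.exp (ψ • Δ ω)) ∂μ = d * v := by
    simp only [hv, normTraceExp_eq, integral_const_mul]
    field_simp
  have hψr : ψ * rFun μ Δ ψ = Real.log v := by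
    rw [rFun, ← hv]
    field_simp
  set c := Real.log v - Real.log m with hc
  have hexp : Real.exp (-c) * v = m := by
    rw [hc, neg_sub, Real.exp_sub, Real.exp_log (by linarith), Real.exp_log (by linarith)]
    field_simp
  have i1 : Integrable (fun ω => reTrace d (Δ ω * NormedSpace.exp (θ • Ψ (Z ω)))) μ :=
    h.integrable_condVar_left hbdd hΔ
      (f := fun p => reTrace d (p.1 * NormedSpace.exp (θ • p.2))) (by fun_prop)
  have i2 : Integrable (fun ω => reTrace d (NormedSpace.exp (θ • Ψ (Z ω)))) μ :=
    h.integrable_left hbdd (f := fun A => reTrace d (NormedSpace.exp (θ • A))) (by fun_prop)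
  have i3 : Integrable (fun ω => reTrace d (Ψ (Z ω) * NormedSpace.exp (θ • Ψ (Z ω)))) μ :=
    h.integrable_left hbdd (f := fun A => reTrace d (A * NormedSpace.exp (θ • A))) (by fun_prop)
  have i4 : Integrable (fun ω => reTrace d (NormedSpace.exp (ψ • Δ ω))) μ :=
    h.integrable_condVar_left hbdd hΔ
      (f := fun p => reTrace d (NormedSpace.exp (ψ • p.1))) (by fun_prop)
  have i5 : Integrable (fun ω => θ * reTrace d (Ψ (Z ω) * NormedSpace.exp (θ • Ψ (Z ω)))
      - reTrace d (NormedSpace.exp (θ • Ψ (Z ω)))) μ := (i3.const_mul _).sub i2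
  have key : ∫ ω, (ψ * reTrace d (Δ ω * NormedSpace.exp (θ • Ψ (Z ω)))
        - c * reTrace d (NormedSpace.exp (θ • Ψ (Z ω)))) ∂μ ≤
      ∫ ω, (θ * reTrace d (Ψ (Z ω) * NormedSpace.exp (θ • Ψ (Z ω)))
        - reTrace d (NormedSpace.exp (θ • Ψ (Z ω)))
        + Real.exp (-c) * reTrace d (NormedSpace.exp (ψ • Δ ω))) ∂μ := by
    refine integral_mono_ae ((i1.const_mul _).sub (i2.const_mul _))
      (i5.add (i4.const_mul _)) ?_
    filter_upwards [h.ae_isHermitian_condVar hbdd hΔ] with ω hω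
    have hY : (θ • Ψ (Z ω)).IsHermitian :=
      (IsSelfAdjoint.all θ).smul (h.isHermitian (Z ω)).isSelfAdjoint
    have h2 : (ψ • Δ ω - c • (1 : Matrix (Fin d) (Fin d) ℂ)).IsHermitian :=
      ((IsSelfAdjoint.all ψ).smul hω.isSelfAdjoint).sub
        ((IsSelfAdjoint.all c).smul (IsSelfAdjoint.one _))
    have h3 := reTrace_mul_exp_le h2 hY
    have h4 : NormedSpace.exp (ψ • Δ ω - c • (1 : Matrix (Fin d) (Fin d) ℂ)) =
        Real.exp (-c) • NormedSpace.exp (ψ • Δ ω) := by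
      rw [sub_eq_add_neg, ← neg_smul, exp_add_smul_one]
    rw [h4, sub_mul, smul_mul_assoc, smul_mul_assoc, smul_mul_assoc, one_mul, map_sub, map_smul,
      map_smul, map_smul, map_smul] at h3
    exact h3
  rw [integral_sub (i1.const_mul _) (i2.const_mul _),
    integral_add i5 (i4.const_mul _), integral_sub (i3.const_mul _) i2,
    integral_const_mul, integral_const_mul, integral_const_mul, integral_const_mul, hM, hV] at key
  have h5 : Real.exp (-c) * (d * v) = d * m := by rw [← hexp]; ring
  rw [h5] at key
  have h6 : 0 ≤ Real.log m * (d * m) :=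
    mul_nonneg (Real.log_nonneg hm1) (by positivity)
  rw [hM, hψr]
  have h7 : c * (d * m) = Real.log v * (d * m) - Real.log m * (d * m) := by rw [hc]; ring
  linarith

/-- The bound on the trace cumulant generating function behind both concentration inequalities. -/
lemma log_integral_normTraceExp_le (hd : 1 ≤ d) (hΔ : IsConditionalVariance μ Z Z' Ψ α Δ)
    {ψ θ : ℝ} (hψ : 0 < ψ) (hθ : 0 ≤ θ) (hθψ : θ < √ψ) :
    Real.log (∫ ω, normTraceExp θ (Ψ (Z ω)) ∂μ) ≤
      rFun μ Δ ψ * θ ^ 2 / (2 * (1 - θ / √ψ)) := by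
  have hd' : (0 : ℝ) < d := by exact_mod_cast hd
  refine log_le_of_deriv_le (m := fun θ => ∫ ω, normTraceExp θ (Ψ (Z ω)) ∂μ)
    (m' := fun θ => (d : ℝ)⁻¹ *
      ∫ ω, reTrace d (Ψ (Z ω) * NormedSpace.exp (θ • Ψ (Z ω))) ∂μ) hψ
    (h.rFun_nonneg hbdd hd hΔ hψ) (fun s => ?_) ?_ (fun s => ?_) (fun s hs => ?_) hθ hθψ
  · simp only [normTraceExp_eq, integral_const_mul]
    exact (h.hasDerivAt_integral_reTrace_exp hbdd s).const_mul _
  · simp only [normTraceExp_eq, zero_smul, NormedSpace.exp_zero, reTrace_one]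
    simp [hd'.ne']
  · exact one_pos.trans_le (h.one_le_integral_normTraceExp hbdd hd s)
  · have h1 := h.integral_reTrace_mul_exp_le hbdd hΔ hs
    have h2 := h.integral_reTrace_condVar_mul_exp_le hbdd hd hΔ hψ s
    simp only [normTraceExp_eq, integral_const_mul]
    set a := ∫ ω, reTrace d (Ψ (Z ω) * NormedSpace.exp (s • Ψ (Z ω))) ∂μ
    set b := ∫ ω, reTrace d (Δ ω * NormedSpace.exp (s • Ψ (Z ω))) ∂μ
    set M := ∫ ω, reTrace d (NormedSpace.exp (s • Ψ (Z ω))) ∂μ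
    have h3 : a * (1 - s ^ 2 / ψ) ≤ rFun μ Δ ψ * s * M := by
      have h4 := mul_le_mul_of_nonneg_left h2 (div_nonneg hs.le hψ.le)
      have h5 : s / ψ * (ψ * b) = s * b := by field_simp
      have h6 : s / ψ * (s * a + ψ * rFun μ Δ ψ * M) =
          s ^ 2 / ψ * a + rFun μ Δ ψ * s * M := by field_simp
      linarith
    have h7 := mul_le_mul_of_nonneg_left h3 (inv_nonneg.2 hd'.le)
    linarith

/-! ### Concentration of the largest eigenvalue -/

lemma aestronglyMeasurable_lambdaMax (hd : 1 ≤ d) :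
    AEStronglyMeasurable (fun ω => lambdaMax (Ψ (Z ω))) μ := by
  have hd' : (0 : ℝ) < d := by exact_mod_cast hd
  -- `lambdaMax A` is the limit of `log (tr (exp (n A))) / n`, and the latter depends
  -- continuously on `A`.
  let u : ℕ → Ω → ℝ := fun n ω =>
    Real.log (reTrace d (NormedSpace.exp (((n : ℝ) + 1) • Ψ (Z ω)))) / ((n : ℝ) + 1)
  have hpos : ∀ n : ℕ, (0 : ℝ) < (n : ℝ) + 1 := fun n => by positivity
  refine aestronglyMeasurable_of_tendsto_ae Filter.atTop (f := u) (fun n => ?_)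
    (.of_forall fun ω => ?_)
  · have h1 := (h.integrable_left hbdd
      (f := fun A => reTrace d (NormedSpace.exp (((n : ℝ) + 1) • A)))
      (by fun_prop)).aestronglyMeasurable.aemeasurable
    exact ((Real.measurable_log.comp_aemeasurable h1).div_const _).aestronglyMeasurable
  · have hA := h.isHermitian (Z ω)
    have hlim : Filter.Tendsto (fun n : ℕ => Real.log d * (1 / ((n : ℝ) + 1)) + lambdaMax (Ψ (Z ω)))
        Filter.atTop (nhds (lambdaMax (Ψ (Z ω)))) := by
      simpa using (tendsto_one_div_add_atTop_nhds_zero_nat.const_mul (Real.log d)).add_const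
        (lambdaMax (Ψ (Z ω)))
    refine tendsto_of_tendsto_of_tendsto_of_le_of_le tendsto_const_nhds hlim (fun n => ?_)
      (fun n => ?_)
    · rw [le_div_iff₀ (hpos n), mul_comm]
      exact (Real.le_log_iff_exp_le
        ((Real.exp_pos _).trans_le (exp_mul_lambdaMax_le hd hA _))).2
        (exp_mul_lambdaMax_le hd hA _)
    · change Real.log _ / _ ≤ _
      rw [div_le_iff₀ (hpos n)]
      have h1 := Real.log_le_log ((Real.exp_pos _).trans_le (exp_mul_lambdaMax_le hd hA _))
        (reTrace_exp_le_card_mul_exp_lambdaMax hA (hpos n).le)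
      rw [Real.log_mul hd'.ne' (Real.exp_ne_zero _), Real.log_exp] at h1
      refine h1.trans_eq ?_
      have := (hpos n).ne'
      field_simp

lemma integrable_lambdaMax (hd : 1 ≤ d) : Integrable (fun ω => lambdaMax (Ψ (Z ω))) μ := by
  obtain ⟨B, hB⟩ := id hbdd
  refine Integrable.of_bound (h.aestronglyMeasurable_lambdaMax hbdd hd)
    (B * ‖(1 : Matrix (Fin d) (Fin d) ℂ)‖) ?_
  filter_upwards [hB] with ω hω
  exact (abs_lambdaMax_le hd (h.isHermitian (Z ω))).trans
    (mul_le_mul_of_nonneg_right hω (norm_nonneg _))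

lemma measureReal_le_lambdaMax_le (hd : 1 ≤ d) (t : ℝ) {θ : ℝ} (hθ : 0 ≤ θ) :
    μ.real {ω | t ≤ lambdaMax (Ψ (Z ω))} ≤
      d * Real.exp (-(θ * t) + Real.log (∫ ω, normTraceExp θ (Ψ (Z ω)) ∂μ)) := by
  have hd' : (0 : ℝ) < d := by exact_mod_cast hd
  have hm := h.one_le_integral_normTraceExp hbdd hd θ
  have i2 : Integrable (fun ω => reTrace d (NormedSpace.exp (θ • Ψ (Z ω)))) μ :=
    h.integrable_left hbdd (f := fun A => reTrace d (NormedSpace.exp (θ • A))) (by fun_prop)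
  have hM : ∫ ω, reTrace d (NormedSpace.exp (θ • Ψ (Z ω))) ∂μ =
      d * ∫ ω, normTraceExp θ (Ψ (Z ω)) ∂μ := by
    simp only [normTraceExp_eq, integral_const_mul]
    field_simp
  have h1 := mul_meas_ge_le_integral_of_nonneg (.of_forall fun ω => (Real.exp_nonneg _).trans
    (exp_mul_lambdaMax_le hd (h.isHermitian (Z ω)) θ)) i2 (Real.exp (θ * t))
  have h2 : μ.real {ω | t ≤ lambdaMax (Ψ (Z ω))} ≤
      μ.real {ω | Real.exp (θ * t) ≤ reTrace d (NormedSpace.exp (θ • Ψ (Z ω)))} :=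
    measureReal_mono fun ω hω => (Real.exp_le_exp.2 (mul_le_mul_of_nonneg_left hω hθ)).trans
      (exp_mul_lambdaMax_le hd (h.isHermitian (Z ω)) θ)
  rw [hM] at h1
  rw [Real.exp_add, Real.exp_log (by linarith), Real.exp_neg]
  refine h2.trans ?_
  rw [mul_left_comm, inv_mul_eq_div, le_div_iff₀ (Real.exp_pos _), mul_comm]
  exact h1

lemma mul_integral_lambdaMax_le (hd : 1 ≤ d) (θ : ℝ) :
    θ * ∫ ω, lambdaMax (Ψ (Z ω)) ∂μ ≤
      Real.log d + Real.log (∫ ω, normTraceExp θ (Ψ (Z ω)) ∂μ) := by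
  have hd' : (0 : ℝ) < d := by exact_mod_cast hd
  have hm := h.one_le_integral_normTraceExp hbdd hd θ
  set m := ∫ ω, normTraceExp θ (Ψ (Z ω)) ∂μ with hmdef
  have hdm : 0 < d * m := by positivity
  rw [← Real.log_mul hd'.ne' (by linarith), ← integral_const_mul]
  -- Jensen's inequality, through the tangent of the logarithm at the mean `d * m`.
  have h0 : Integrable (fun ω => normTraceExp θ (Ψ (Z ω)) / m) μ :=
    (h.integrable_normTraceExp hbdd θ).div_const m
  have h1 : ∫ ω, (normTraceExp θ (Ψ (Z ω)) / m + (Real.log (d * m) - 1)) ∂μ =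
      Real.log (d * m) := by
    rw [integral_add h0 (integrable_const _), integral_div, ← hmdef, div_self (by linarith)]
    simp
  refine (integral_mono ((h.integrable_lambdaMax hbdd hd).const_mul θ)
    (h0.add (integrable_const _)) fun ω => ?_).trans_eq h1
  have h2 := exp_mul_lambdaMax_le hd (h.isHermitian (Z ω)) θ
  have h3 : 0 < reTrace d (NormedSpace.exp (θ • Ψ (Z ω))) := (Real.exp_pos _).trans_le h2
  have h4 := Real.log_le_sub_one_of_pos (div_pos h3 hdm)
  rw [Real.log_div h3.ne' hdm.ne'] at h4
  have h5 := (Real.le_log_iff_exp_le h3).2 h2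
  have h6 : normTraceExp θ (Ψ (Z ω)) / m =
      reTrace d (NormedSpace.exp (θ • Ψ (Z ω))) / (d * m) := by
    rw [normTraceExp_eq]
    field_simp
  change _ ≤ normTraceExp θ (Ψ (Z ω)) / m + (Real.log (d * m) - 1)
  linarith

end IsMatrixSteinPair

end TraceMgf

end MatrixStein

theorem mainTheorem2 {Ω S : Type*} [MeasurableSpace Ω]
    [TopologicalSpace S] [PolishSpace S] [MeasurableSpace S] [BorelSpace S]
    (μ : Measure Ω) [IsProbabilityMeasure μ] (d : ℕ) (hd : 1 ≤ d)
    (Z Z' : Ω → S) (Ψ : S → Matrix (Fin d) (Fin d) ℂ) (α : ℝ)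
    (hpair : MatrixStein.IsMatrixSteinPair μ Z Z' Ψ α)
    (hbdd : ∃ B : ℝ, ∀ᵐ ω ∂μ, ‖Ψ (Z ω)‖ ≤ B)
    (Δ : Ω → Matrix (Fin d) (Fin d) ℂ)
    (hΔ : MatrixStein.IsConditionalVariance μ Z Z' Ψ α Δ) :
    (∀ ψ : ℝ, 0 < ψ → Integrable (fun ω => MatrixStein.normTraceExp ψ (Δ ω)) μ) ∧
    (∀ t ψ : ℝ, 0 ≤ t → 0 < ψ →
      μ.real {ω | t ≤ MatrixStein.lambdaMax (Ψ (Z ω))} ≤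
        d * Real.exp (-t ^ 2 / (2 * MatrixStein.rFun μ Δ ψ + 2 * t / √ψ))) ∧
    Integrable (fun ω => MatrixStein.lambdaMax (Ψ (Z ω))) μ ∧
    (∀ ψ : ℝ, 0 < ψ →
      ∫ ω, MatrixStein.lambdaMax (Ψ (Z ω)) ∂μ ≤
        √(2 * MatrixStein.rFun μ Δ ψ * Real.log d) + Real.log d / √ψ) := by
  refine ⟨fun ψ _ => hpair.integrable_normTraceExp_condVar hbdd hΔ ψ, fun t ψ ht hψ => ?_,
    hpair.integrable_lambdaMax hbdd hd, fun ψ hψ => ?_⟩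
  · refine MatrixStein.le_mul_exp_of_forall_laplace hψ (hpair.rFun_nonneg hbdd hd hΔ hψ) ht
      fun θ hθ hθψ => (hpair.measureReal_le_lambdaMax_le hbdd hd t hθ).trans ?_
    gcongr
    exact hpair.log_integral_normTraceExp_le hbdd hd hΔ hψ hθ hθψ
  · refine MatrixStein.le_sqrt_add_of_forall_laplace hψ (hpair.rFun_nonneg hbdd hd hΔ hψ)
      (Real.log_nonneg (by exact_mod_cast hd)) fun θ hθ hθψ =>
      (hpair.mul_integral_lambdaMax_le hbdd hd θ).trans ?_
    gcongr
    exact hpair.log_integral_normTraceExp_le hbdd hd hΔ hψ hθ.le hθψ
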